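/- Let $F$ be a CNF formula over Boolean variables $x_1,\dots,x_n$. A *Semantic Cutting Planes refutation* of $F$ is a finite directed acyclic graph of fan-out at most $2$, each node $v$ of which is labelled with a halfspace $H_v\subseteq\mathbb{R}^n$ (the set of solutions of a linear inequality $a\cdot x\ge c$ with real coefficients, where $a=0$ is allowed), such that: (i) there is a unique source node, and it is labelled with $\mathbb{R}^n$; (ii) for every non-sink node $u$, $H_u\cap\{0,1\}^n$ is contained in the union of the halfspaces of the children of $u$; (iii) for every sink node $u$ there is a clause $C$ of $F$ that is falsified by every point of $H_u\cap\{0,1\}^n$. The *depth* of the refutation is the length (number of edges) of a longest directed path in it, and $\mathrm{depth}_{\mathsf{sCP}}(F)$ is the smallest depth of a Semantic Cutting Planes refutation of $F$. Let $\mathrm{XOR}(m,n,k)$ be the distribution of a list of $m$ equations sampled independently and uniformly (with replacement) from the set of all linear equations $\sum_{i\in S}x_i=b$ over $\mathbb{F}_2$ with $S\subseteq[n]$, $|S|=k$, $b\in\mathbb{F}_2$. Such a list is regarded as the CNF formula that contains, for each of its equations and each assignment to the $k$ variables of the equation that violates it, the clause on exactly these $k$ variables that forbids this assignment. Let $\mathcal{F}(m,n,k)$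 be the distribution of a CNF formula given by $m$ clauses sampled independently and uniformly (with replacement) from the set of all $2^k\binom{n}{k}$ clauses with exactly $k$ literals on $k$ distinct variables among $x_1,\dots,x_n$. **Theorem.** Let $k\ge 6$ be a fixed integer. 1. There are $m=m(n)=O(n)$ and a constant $\kappa>0$ such that, with probability tending to $1$ as $n\to\infty$, $F\sim\mathrm{XOR}(m,n,k)$ is unsatisfiable and $\mathrm{depth}_{\mathsf{sCP}}(F)\ge\kappa n$. 2. There are $m=m(n)=O(n)$ and a constant $\kappa>0$ such that, with probability tending to $1$ as $n\to\infty$, $F\sim\mathcal{F}(m,n,k)$ is unsatisfiable and $\mathrm{depth}_{\mathsf{sCP}}(F)\ge\kappa n$. -/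

import Mathlib

open Filter Topology Asymptotics

namespace SemanticCP

/-! ### CNF formulas -/

/-- A literal over `x₀, …, xₙ₋₁`: `(i, true)` is `xᵢ` and `(i, false)` is `¬ xᵢ`. -/
abbrev Literal (n : ℕ) := Fin n × Bool

/-- A clause: the disjunction of a finite set of literals. -/
abbrev Clause (n : ℕ) := Finset (Literal n)

/-- A CNF formula: the conjunction of a finite set of clauses. -/
abbrev CNF (n : ℕ) := Finset (Clause n)

/-- The assignment `x` satisfies the clause `C`. -/
def Clause.Sat {n : ℕ} (C : Clause n) (x : Fin n → Bool) : Prop :=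
  ∃ l ∈ C, x l.1 = l.2

/-- No assignment satisfies all clauses of `F`. -/
def CNF.Unsat {n : ℕ} (F : CNF n) : Prop :=
  ∀ x : Fin n → Bool, ∃ C ∈ F, ¬ Clause.Sat C x

/-! ### Semantic Cutting Planes -/

/-- A linear inequality `a · x ≥ c` over `ℝⁿ`; the case `a = 0` is allowed, so that the
trivially true inequality `0 ≥ -1` is one of them. -/
structure LinIneq (n : ℕ) where
  a : Fin n → ℝ
  c : ℝ

/-- The halfspace of the points that satisfy the inequality. -/
def LinIneq.halfspace {n : ℕ} (L : LinIneq n) : Set (Fin n → ℝ) :=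
  {x | L.c ≤ ∑ i, L.a i * x i}

/-- A Boolean assignment as a vertex of the cube `{0,1}ⁿ ⊆ ℝⁿ`. -/
def boolPoint {n : ℕ} (x : Fin n → Bool) : Fin n → ℝ :=
  fun i => if x i then 1 else 0

/-- A (top-down) Semantic Cutting Planes refutation of the CNF formula `F`: a finite directed
acyclic graph of fan-out at most two whose nodes are labelled with halfspaces. -/
structure Refutation {n : ℕ} (F : CNF n) where
  /-- the number of nodes -/
  size : ℕ
  /-- `edge u v` says that `v` is a child of `u` -/
  edge : Fin size → Fin size → Prop
  /-- the inequality that labels a node -/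
  label : Fin size → LinIneq n
  /-- the source node -/
  root : Fin size
  acyclic : ∀ u, ¬ Relation.TransGen edge u u
  fanout_le_two : ∀ u, {v | edge u v}.encard ≤ 2
  /-- the root is the unique source -/
  source_iff : ∀ v, (∀ u, ¬ edge u v) ↔ v = root
  /-- the root is labelled with the whole space -/
  root_label : (label root).halfspace = Set.univ
  /-- the Boolean points of a non-leaf node are covered by its children -/
  internal : ∀ u, (∃ v, edge u v) → ∀ x : Fin n → Bool,
    boolPoint x ∈ (label u).halfspace → ∃ v, edge u v ∧ boolPoint x ∈ (label v).halfspace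
  /-- all Boolean points of a leaf falsify one and the same clause of `F` -/
  leaf : ∀ u, (∀ v, ¬ edge u v) → ∃ C ∈ F, ∀ x : Fin n → Bool,
    boolPoint x ∈ (label u).halfspace → ¬ Clause.Sat C x

/-- `π.HasPath ℓ`: the graph of `π` has a directed path with `ℓ` edges. -/
def Refutation.HasPath {n : ℕ} {F : CNF n} (π : Refutation F) (ℓ : ℕ) : Prop :=
  ∃ p : Fin (ℓ + 1) → Fin π.size, ∀ i : Fin ℓ, π.edge (p i.castSucc) (p i.succ)

/-- The depth of a refutation: the length of a longest directed path. -/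
noncomputable def Refutation.depth {n : ℕ} {F : CNF n} (π : Refutation F) : ℕ∞ :=
  ⨆ (ℓ : ℕ) (_ : π.HasPath ℓ), (ℓ : ℕ∞)

/-- The smallest depth of a Semantic Cutting Planes refutation of `F` (`⊤` if there is none). -/
noncomputable def depthSCP {n : ℕ} (F : CNF n) : ℕ∞ :=
  ⨅ π : Refutation F, π.depth

/-! ### Random formulas -/

/-- Clauses with exactly `k` literals, on `k` distinct variables. -/
abbrev KClause (n k : ℕ) :=
  {C : Clause n // C.card = k ∧ (C.image Prod.fst).card = k}

/-- Linear equations `∑ i ∈ S, xᵢ = b` over `𝔽₂` with exactly `k` variables. -/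
abbrev KXor (n k : ℕ) := {S : Finset (Fin n) // S.card = k} × ZMod 2

/-- The assignment `x` satisfies the equation `E`. -/
def KXor.Sat {n k : ℕ} (E : KXor n k) (x : Fin n → Bool) : Prop :=
  ∑ i ∈ E.1.1, (if x i then (1 : ZMod 2) else 0) = E.2

instance {n k : ℕ} (E : KXor n k) : DecidablePred E.Sat :=
  fun _ => inferInstanceAs (Decidable (_ = _))

/-- The clausal encoding of an equation: for each assignment to its variables that violates the
equation, the clause on exactly these variables that forbids this assignment. -/
def KXor.toCNF {n k : ℕ} (E : KXor n k) : CNF n :=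
  (Finset.univ.filter fun x : Fin n → Bool => ¬ E.Sat x).image
    fun x => E.1.1.image fun i => (i, !(x i))

/-- The CNF formula of a list of `m` equations. -/
def xorFormula {m n k : ℕ} (E : Fin m → KXor n k) : CNF n :=
  Finset.univ.biUnion fun j => (E j).toCNF

/-- The CNF formula of a list of `m` clauses. -/
def cnfFormula {m n k : ℕ} (C : Fin m → KClause n k) : CNF n :=
  Finset.univ.image fun j => (C j).1

/-- The probability of the event `A` under the uniform distribution on the finite set `Ω`.
For `Ω = Fin m → α` this is `m` independent uniform samples from `α`. -/
noncomputable def uniformProb {Ω : Type} [Fintype Ω] (A : Set Ω) : ℝ :=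
  (A.ncard : ℝ) / (Fintype.card Ω : ℝ)

end SemanticCP

/-! The lower bound walks down a refutation from its root, keeping in the current halfspace a
partially integral point: coordinates in a small set are Boolean, all others are 1/2. If Boolean
points of a halfspace are covered by two others, one of these contains such a point with at most two
more Boolean coordinates (`exists_midPoint_mem_of_cover`). Otherwise a planar balancing argument
rounds the point to a vertex of the first halfspace that lies in neither child.

To keep a leaf from being reached, the integral coordinates must never violate a constraint. So they
always include the variables of a closure, a maximal set of edges with small boundary outside the
fixed variables, and its parity constraints hold. Expansion bounds the closure linearly
(`IsClosure.card_le_two_mul`), and edges outside it keep many free boundary vertices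
(`IsClosure.lt_card_boundary`). With two of them for every nonempty set of edges, the solutions of
the new constraints average to 1/2 in each free coordinate, so some solution does not decrease the
linear form of the label (`exists_parity_eq_of_two_le`). The walk therefore continues for a number
of steps linear in the expansion size (`Refutation.exists_path`).

It remains to see that random constraints are unsatisfiable and expand up to linear size, two union
bounds combined in `exists_tendsto_uniformProb_expanding`. Random clauses reduce to parities: a
clause is falsified by one assignment to its variables, hence is implied by the opposite parity
(`sat_of_parity_eq`). -/

namespace SemanticCP

/-! ### Signing vectors in the plane -/

/-- Three or more vectors of the plane are linearly dependent. -/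
theorem exists_planar_relation {ι : Type*} [DecidableEq ι] (A : Finset ι) (hA : 2 < A.card)
    (b d : ι → ℝ) :
    ∃ w : ι → ℝ, (∀ i ∉ A, w i = 0) ∧ (∃ i ∈ A, w i ≠ 0) ∧
      ∑ i ∈ A, b i * w i = 0 ∧ ∑ i ∈ A, d i * w i = 0 := by
  have hdep : ¬ LinearIndependent ℝ (fun i : A => ((b i, d i) : ℝ × ℝ)) := by
    intro h
    have := h.fintype_card_le_finrank
    simp at this
    omega
  obtain ⟨g, hg, i, hi⟩ := Fintype.not_linearIndependent_iff.1 hdep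
  have h1 : ∑ i : A, b i * g i = 0 := by
    have := congrArg Prod.fst hg
    simpa [Prod.fst_sum, mul_comm] using this
  have h2 : ∑ i : A, d i * g i = 0 := by
    have := congrArg Prod.snd hg
    simpa [Prod.snd_sum, mul_comm] using this
  refine ⟨fun i => if h : i ∈ A then g ⟨i, h⟩ else 0, fun i hi => by simp [hi],
    ⟨i, i.2, by simpa using hi⟩, ?_, ?_⟩
  · rw [← Finset.sum_coe_sort A, ← h1]
    exact Finset.sum_congr rfl fun i _ => by simp
  · rw [← Finset.sum_coe_sort A, ← h2]
    exact Finset.sum_congr rfl fun i _ => by simp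

/-- A line through a point of the box `[-1, 1]ᴬ` that is interior in all coordinates meets the
boundary of the box. -/
theorem exists_move_to_face {ι : Type*} (A : Finset ι) (y w : ι → ℝ)
    (hy : ∀ i ∈ A, |y i| < 1) (hw : ∃ i ∈ A, w i ≠ 0) :
    ∃ t : ℝ, (∀ i ∈ A, |y i + t * w i| ≤ 1) ∧ ∃ i ∈ A, |y i + t * w i| = 1 := by
  classical
  -- The time at which coordinate `i`, moving with velocity `w i`, leaves `[-1, 1]`; the least such
  -- time over `w i ≠ 0` is used.
  let f : ι → ℝ := fun i => if 0 < w i then (1 - y i) / w i else (-1 - y i) / w i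
  obtain ⟨i₁, hi₁, hwi₁⟩ := hw
  obtain ⟨i₀, hi₀, hmin⟩ := Finset.exists_min_image (A.filter fun i => w i ≠ 0) f
    ⟨i₁, by simp [hi₁, hwi₁]⟩
  simp only [Finset.mem_filter, and_imp] at hi₀ hmin
  have hpos : ∀ i ∈ A, w i ≠ 0 → 0 < f i := by
    intro i hi hwi
    have := abs_lt.1 (hy i hi)
    by_cases h : 0 < w i
    · simp only [f, h, if_true]
      exact div_pos (by linarith) h
    · simp only [f, h, if_false]
      exact div_pos_of_neg_of_neg (by linarith) (lt_of_le_of_ne (not_lt.1 h) hwi)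
  refine ⟨f i₀, fun i hi => ?_, i₀, hi₀.1, ?_⟩
  · have hyi := abs_lt.1 (hy i hi)
    have h0 := hpos i₀ hi₀.1 hi₀.2
    rcases eq_or_ne (w i) 0 with h | h
    · simpa [h] using (hy i hi).le
    have hle := hmin i hi h
    rw [abs_le]
    by_cases hp : 0 < w i
    · have h2 : f i * w i = 1 - y i := by
        simp only [f, hp, if_true]
        exact div_mul_cancel₀ _ h
      have h3 := mul_le_mul_of_nonneg_right hle hp.le
      have h4 := mul_pos h0 hp
      constructor <;> linarith
    · have hn : w i < 0 := lt_of_le_of_ne (not_lt.1 hp) h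
      have h2 : f i * w i = -1 - y i := by
        simp only [f, hp, if_false]
        exact div_mul_cancel₀ _ h
      have h3 := mul_le_mul_of_nonpos_right hle hn.le
      have h4 := mul_neg_of_pos_of_neg h0 hn
      constructor <;> linarith
  · by_cases hp : 0 < w i₀
    · have h2 : f i₀ * w i₀ = 1 - y i₀ := by
        simp only [f, hp, if_true]
        exact div_mul_cancel₀ _ hi₀.2
      rw [h2]; simp
    · have h2 : f i₀ * w i₀ = -1 - y i₀ := by
        simp only [f, hp, if_false]
        exact div_mul_cancel₀ _ hi₀.2
      rw [h2]; simp

/-- The origin can be moved within `[-1, 1]ᵁ`, preserving two linear forms, to a point with at most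
two coordinates that are not `±1`. -/
theorem exists_almost_integral {ι : Type*} [DecidableEq ι] (U : Finset ι) (b d : ι → ℝ) :
    ∃ y : ι → ℝ, (∀ i ∈ U, |y i| ≤ 1) ∧ ∑ i ∈ U, b i * y i = 0 ∧ ∑ i ∈ U, d i * y i = 0 ∧
      (U.filter fun i => |y i| < 1).card ≤ 2 := by
  -- Induction on the number of fractional coordinates: while there are three, a relation among
  -- their coefficient vectors is a direction that preserves both forms and can be followed to a
  -- face.
  suffices H : ∀ N : ℕ, ∀ y : ι → ℝ, (∀ i ∈ U, |y i| ≤ 1) → ∑ i ∈ U, b i * y i = 0 →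
      ∑ i ∈ U, d i * y i = 0 → (U.filter fun i => |y i| < 1).card ≤ N →
      ∃ y : ι → ℝ, (∀ i ∈ U, |y i| ≤ 1) ∧ ∑ i ∈ U, b i * y i = 0 ∧ ∑ i ∈ U, d i * y i = 0 ∧
        (U.filter fun i => |y i| < 1).card ≤ 2 from
    H _ (fun _ => 0) (by simp) (by simp) (by simp) le_rfl
  intro N
  induction N with
  | zero => exact fun y h1 h2 h3 h4 => ⟨y, h1, h2, h3, by omega⟩
  | succ N ih =>
    intro y h1 h2 h3 h4
    by_cases hc : (U.filter fun i => |y i| < 1).card ≤ 2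
    · exact ⟨y, h1, h2, h3, hc⟩
    set A := U.filter fun i => |y i| < 1 with hAdef
    have hAU : A ⊆ U := Finset.filter_subset _ _
    obtain ⟨w, hw0, hw1, hb, hd⟩ := exists_planar_relation A (not_le.1 hc) b d
    obtain ⟨t, ht, i₀, hi₀, ht₀⟩ := exists_move_to_face A y w
      (fun i hi => (Finset.mem_filter.1 hi).2) hw1
    have hsum : ∀ e : ι → ℝ, ∑ i ∈ A, e i * w i = 0 →
        ∑ i ∈ U, e i * (y i + t * w i) = ∑ i ∈ U, e i * y i := by
      intro e he
      have h5 : ∑ i ∈ U, e i * w i = 0 := by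
        rw [← he]
        exact (Finset.sum_subset hAU fun i _ hi => by simp [hw0 i hi]).symm
      have h6 : ∑ i ∈ U, e i * (y i + t * w i) =
          ∑ i ∈ U, e i * y i + t * ∑ i ∈ U, e i * w i := by
        rw [Finset.mul_sum, ← Finset.sum_add_distrib]
        exact Finset.sum_congr rfl fun i _ => by ring
      rw [h6, h5, mul_zero, add_zero]
    refine ih (fun i => y i + t * w i) (fun i hi => ?_) ((hsum b hb).trans h2)
      ((hsum d hd).trans h3) ?_
    · by_cases hiA : i ∈ A
      · exact ht i hiA
      · simpa [hw0 i hiA] using h1 i hi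
    · have hlt : (U.filter fun i => |y i + t * w i| < 1).card < A.card := by
        apply Finset.card_lt_card
        refine (Finset.ssubset_iff_of_subset fun i hi => ?_).2
          ⟨i₀, hi₀, by simp [ht₀]⟩
        by_contra hiA
        rw [Finset.mem_filter, hw0 i hiA, mul_zero, add_zero] at hi
        exact hiA (Finset.mem_filter.2 hi)
      omega

/-- Two linear forms whose coefficients are small can be balanced simultaneously by signs. -/
theorem exists_signing {ι : Type*} [DecidableEq ι] (U : Finset ι) (b d : ι → ℝ)
    (hb : ∀ A ⊆ U, A.card ≤ 2 → ∑ i ∈ A, |b i| < 1)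
    (hd : ∀ A ⊆ U, A.card ≤ 2 → ∑ i ∈ A, |d i| < 1) :
    ∃ ε : ι → ℝ, (∀ i, ε i = 1 ∨ ε i = -1) ∧
      |∑ i ∈ U, b i * ε i| < 1 ∧ |∑ i ∈ U, d i * ε i| < 1 := by
  obtain ⟨y, hy, hyb, hyd, hA⟩ := exists_almost_integral U b d
  set A := U.filter fun i => |y i| < 1 with hAdef
  have hAU : A ⊆ U := Finset.filter_subset _ _
  -- Rounding to the nearest sign changes only the at most two fractional coordinates, each by at
  -- most 1.
  let ε : ι → ℝ := fun i => if 0 ≤ y i then 1 else -1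
  have hε : ∀ i ∈ U, i ∉ A → ε i - y i = 0 := by
    intro i hi hiA
    have h1 : |y i| = 1 :=
      le_antisymm (hy i hi) (not_lt.1 fun h => hiA (Finset.mem_filter.2 ⟨hi, h⟩))
    rcases (abs_eq zero_le_one).1 h1 with h | h <;> (simp [ε, h]; try norm_num)
  have hε' : ∀ i ∈ U, |ε i - y i| ≤ 1 := by
    intro i hi
    have := abs_le.1 (hy i hi)
    by_cases h : 0 ≤ y i
    · simp only [ε, h, if_true]; rw [abs_le]; constructor <;> linarith
    · simp only [ε, h, if_false]; rw [abs_le]; constructor <;> linarith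
  have key : ∀ e : ι → ℝ, ∑ i ∈ U, e i * y i = 0 → ∑ i ∈ A, |e i| < 1 →
      |∑ i ∈ U, e i * ε i| < 1 := by
    intro e he hlt
    have h1 : ∑ i ∈ U, e i * ε i = ∑ i ∈ A, e i * (ε i - y i) := by
      rw [Finset.sum_subset hAU fun i hi hiA => by rw [hε i hi hiA, mul_zero]]
      simp only [mul_sub, Finset.sum_sub_distrib, he, sub_zero]
    rw [h1]
    refine lt_of_le_of_lt (Finset.abs_sum_le_sum_abs _ _) (lt_of_le_of_lt ?_ hlt)
    refine Finset.sum_le_sum fun i hi => ?_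
    rw [abs_mul]
    exact mul_le_of_le_one_right (abs_nonneg _) (hε' i (hAU hi))
  refine ⟨ε, fun i => ?_, key b hyb (hb A hAU hA), key d hyd (hd A hAU hA)⟩
  by_cases h : 0 ≤ y i <;> simp [ε, h]

/-! ### Partially integral points -/

/-- The point that agrees with `x` on `D` and has all other coordinates equal to `1/2`. -/
noncomputable def midPoint {n : ℕ} (D : Finset (Fin n)) (x : Fin n → Bool) : Fin n → ℝ :=
  fun i => if i ∈ D then boolPoint x i else 1 / 2

theorem midPoint_univ {n : ℕ} (x : Fin n → Bool) : midPoint Finset.univ x = boolPoint x := by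
  ext i; simp [midPoint]

theorem sum_mul_midPoint_union {n : ℕ} (a : Fin n → ℝ) {D A : Finset (Fin n)}
    (hDA : Disjoint D A) {x y : Fin n → Bool} (hxy : ∀ i ∈ D, y i = x i) :
    ∑ i, a i * midPoint (D ∪ A) y i =
      ∑ i, a i * midPoint D x i + ∑ i ∈ A, a i * (boolPoint y i - 1 / 2) := by
  have h : ∑ i ∈ A, a i * (boolPoint y i - 1 / 2) =
      ∑ i, if i ∈ A then a i * (boolPoint y i - 1 / 2) else 0 := by simp
  rw [h, ← Finset.sum_add_distrib]
  refine Finset.sum_congr rfl fun i _ => ?_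
  by_cases hD : i ∈ D
  · have hA : i ∉ A := Finset.disjoint_left.1 hDA hD
    simp [midPoint, hD, hA, boolPoint, hxy i hD]
  · by_cases hA : i ∈ A
    · simp [midPoint, hD, hA]; ring
    · simp [midPoint, hD, hA]

/-- Rounding each coordinate in `A` towards the sign of its coefficient gains `|L.a i| / 2`. If even
this best rounding misses the halfspace, the total gain is below the slack at the current point. -/
theorem sum_abs_lt_of_notMem_halfspace {n : ℕ} {L : LinIneq n} {D : Finset (Fin n)}
    {x : Fin n → Bool}
    (h : ∀ A : Finset (Fin n), Disjoint D A → A.card ≤ 2 → ∀ y : Fin n → Bool,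
      (∀ i ∈ D, y i = x i) → midPoint (D ∪ A) y ∉ L.halfspace)
    {A : Finset (Fin n)} (hDA : Disjoint D A) (hA : A.card ≤ 2) :
    ∑ i ∈ A, |L.a i| / 2 < L.c - ∑ i, L.a i * midPoint D x i := by
  let y : Fin n → Bool := fun i => if i ∈ D then x i else decide (0 ≤ L.a i)
  have hy : ∀ i ∈ D, y i = x i := fun i hi => by simp [y, hi]
  have h1 := h A hDA hA y hy
  simp only [LinIneq.halfspace, Set.mem_ofPred_eq, not_le] at h1
  rw [sum_mul_midPoint_union L.a hDA hy] at h1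
  have h2 : ∑ i ∈ A, L.a i * (boolPoint y i - 1 / 2) = ∑ i ∈ A, |L.a i| / 2 := by
    refine Finset.sum_congr rfl fun i hi => ?_
    have hD : i ∉ D := Finset.disjoint_right.1 hDA hi
    by_cases h0 : 0 ≤ L.a i
    · simp [boolPoint, y, hD, h0, abs_of_nonneg h0]; ring
    · simp [boolPoint, y, hD, h0, abs_of_neg (not_le.1 h0)]; ring
  linarith

/-- If a halfspace contains a partially integral point and its Boolean points are covered by two
halfspaces, then one of the two contains a partially integral point with at most two more integral
coordinates. -/
theorem exists_midPoint_mem_of_cover {n : ℕ} {L L₁ L₂ : LinIneq n} {D : Finset (Fin n)}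
    {x : Fin n → Bool} (hx : midPoint D x ∈ L.halfspace)
    (hcov : ∀ y : Fin n → Bool, boolPoint y ∈ L.halfspace →
      boolPoint y ∈ L₁.halfspace ∨ boolPoint y ∈ L₂.halfspace) :
    ∃ A : Finset (Fin n), Disjoint D A ∧ A.card ≤ 2 ∧ ∃ y : Fin n → Bool,
      (∀ i ∈ D, y i = x i) ∧
        (midPoint (D ∪ A) y ∈ L₁.halfspace ∨ midPoint (D ∪ A) y ∈ L₂.halfspace) := by
  -- If every rounding of two coordinates misses both halfspaces, then after division by the slacks
  -- `g₁` and `g₂` the half-coefficients satisfy the smallness hypotheses of `exists_signing`.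
  by_contra hcon
  push Not at hcon
  have hgap := fun (A : Finset (Fin n)) (h1 : Disjoint D A) (h2 : A.card ≤ 2) =>
    And.intro
      (sum_abs_lt_of_notMem_halfspace (fun A h1 h2 y hy => (hcon A h1 h2 y hy).1) h1 h2)
      (sum_abs_lt_of_notMem_halfspace (fun A h1 h2 y hy => (hcon A h1 h2 y hy).2) h1 h2)
  set g₁ := L₁.c - ∑ i, L₁.a i * midPoint D x i with hg₁
  set g₂ := L₂.c - ∑ i, L₂.a i * midPoint D x i with hg₂
  have hg1 : 0 < g₁ := by simpa using (hgap ∅ (by simp) (by simp)).1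
  have hg2 : 0 < g₂ := by simpa using (hgap ∅ (by simp) (by simp)).2
  have hnorm : ∀ (A : Finset (Fin n)) (g : ℝ) (a : Fin n → ℝ), 0 < g → ∑ i ∈ A, |a i| / 2 < g →
      ∑ i ∈ A, |a i / 2 / g| < 1 := by
    intro A g a hg h
    have : ∑ i ∈ A, |a i / 2 / g| = (∑ i ∈ A, |a i| / 2) / g := by
      rw [Finset.sum_div]
      refine Finset.sum_congr rfl fun i _ => ?_
      rw [abs_div, abs_div, abs_of_pos hg, abs_two]
    rw [this, div_lt_one hg]
    exact h
  obtain ⟨ε, hε, h1, h2⟩ := exists_signing Dᶜ (fun i => L₁.a i / 2 / g₁) (fun i => L₂.a i / 2 / g₂)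
    (fun A hA hc => hnorm A _ _ hg1
      (hgap A (Finset.disjoint_left.2 fun i hi hiA => by simpa [hi] using hA hiA) hc).1)
    (fun A hA hc => hnorm A _ _ hg2
      (hgap A (Finset.disjoint_left.2 fun i hi hiA => by simpa [hi] using hA hiA) hc).2)
  -- The two bounds are symmetric under `ε ↦ -ε`, so the global sign is free to be chosen in favour
  -- of `L`.
  obtain ⟨ε, hε, h0, h1, h2⟩ : ∃ ε : Fin n → ℝ, (∀ i, ε i = 1 ∨ ε i = -1) ∧
      0 ≤ ∑ i ∈ Dᶜ, L.a i * ε i ∧ ∑ i ∈ Dᶜ, L₁.a i / 2 / g₁ * ε i < 1 ∧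
        ∑ i ∈ Dᶜ, L₂.a i / 2 / g₂ * ε i < 1 := by
    rcases le_total 0 (∑ i ∈ Dᶜ, L.a i * ε i) with h | h
    · exact ⟨ε, hε, h, (abs_lt.1 h1).2, (abs_lt.1 h2).2⟩
    · refine ⟨fun i => - ε i, fun i => ?_, ?_, ?_, ?_⟩
      · rcases hε i with h | h <;> simp [h]
      · simpa using h
      · simp only [mul_neg, Finset.sum_neg_distrib]
        linarith [(abs_lt.1 h1).1]
      · simp only [mul_neg, Finset.sum_neg_distrib]
        linarith [(abs_lt.1 h2).1]
  let y : Fin n → Bool := fun i => if i ∈ D then x i else decide (0 < ε i)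
  have hy : ∀ i ∈ D, y i = x i := fun i hi => by simp [y, hi]
  have hpt : ∀ a : Fin n → ℝ, ∑ i, a i * boolPoint y i =
      ∑ i, a i * midPoint D x i + (∑ i ∈ Dᶜ, a i * ε i) / 2 := by
    intro a
    have := sum_mul_midPoint_union a (D := D) (A := Dᶜ) disjoint_compl_right hy
    rw [Finset.union_compl, midPoint_univ] at this
    rw [this, Finset.sum_div]
    congr 1
    refine Finset.sum_congr rfl fun i hi => ?_
    have hD : i ∉ D := by simpa using hi
    rcases hε i with h | h <;> norm_num [boolPoint, y, hD, h] <;> ring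
  have hscale : ∀ (g : ℝ) (a : Fin n → ℝ), 0 < g → ∑ i ∈ Dᶜ, a i / 2 / g * ε i < 1 →
      (∑ i ∈ Dᶜ, a i * ε i) / 2 < g := by
    intro g a hg h
    have : ∑ i ∈ Dᶜ, a i / 2 / g * ε i = (∑ i ∈ Dᶜ, a i * ε i) / 2 / g := by
      rw [Finset.sum_div, Finset.sum_div]
      exact Finset.sum_congr rfl fun i _ => by ring
    rwa [this, div_lt_one hg] at h
  have hL : boolPoint y ∈ L.halfspace := by
    simp only [LinIneq.halfspace, Set.mem_ofPred_eq] at hx ⊢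
    rw [hpt]
    linarith
  rcases hcov y hL with h | h
  · simp only [LinIneq.halfspace, Set.mem_ofPred_eq] at h
    rw [hpt] at h
    linarith [hscale _ _ hg1 h1]
  · simp only [LinIneq.halfspace, Set.mem_ofPred_eq] at h
    rw [hpt] at h
    linarith [hscale _ _ hg2 h2]

/-! ### Systems of parity constraints -/

/-- The parity of the assignment `x` on the set of variables `s`. -/
def parity {n : ℕ} (s : Finset (Fin n)) (x : Fin n → Bool) : ZMod 2 :=
  ∑ i ∈ s, if x i then 1 else 0

theorem parity_xor {n : ℕ} (s : Finset (Fin n)) (x w : Fin n → Bool) :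
    parity s (fun i => xor (x i) (w i)) = parity s x + parity s w := by
  unfold parity
  rw [← Finset.sum_add_distrib]
  refine Finset.sum_congr rfl fun i _ => ?_
  cases hx : x i <;> cases hw : w i <;> simp [hx, hw]
  decide

theorem parity_single {n : ℕ} (s : Finset (Fin n)) (i : Fin n) :
    parity s (fun i' => decide (i' = i)) = if i ∈ s then 1 else 0 := by
  simp [parity]

theorem parity_congr {n : ℕ} {s : Finset (Fin n)} {x y : Fin n → Bool}
    (h : ∀ i ∈ s, x i = y i) : parity s x = parity s y :=
  Finset.sum_congr rfl fun i hi => by rw [h i hi]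

section Hypergraph

variable {n : ℕ} {ι : Type*} (S : ι → Finset (Fin n))

/-- The boundary of a set `T` of edges of the hypergraph `S`: the vertices that lie on exactly one
edge of `T`. -/
def boundary (T : Finset ι) : Finset (Fin n) :=
  Finset.univ.filter fun i => (T.filter fun j => i ∈ S j).card = 1

variable {S}

theorem mem_boundary {T : Finset ι} {i : Fin n} :
    i ∈ boundary S T ↔ (T.filter fun j => i ∈ S j).card = 1 := by
  simp [boundary]

/-- If all sets of constraints have a free boundary variable, the system can be solved. -/
theorem exists_parity_eq [DecidableEq ι] (D : Finset (Fin n)) (c : ι → ZMod 2)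
    (x₀ : Fin n → Bool) (T : Finset ι)
    (hT : ∀ T' ⊆ T, T'.Nonempty → (boundary S T' \ D).Nonempty) :
    ∃ x : Fin n → Bool, (∀ i ∈ D, x i = x₀ i) ∧ ∀ j ∈ T, parity (S j) x = c j := by
  induction T using Finset.strongInduction with
  | H T ih =>
    rcases T.eq_empty_or_nonempty with rfl | hne
    · exact ⟨x₀, fun _ _ => rfl, by simp⟩
    obtain ⟨i, hi⟩ := hT T subset_rfl hne
    obtain ⟨hi, hiD⟩ := Finset.mem_sdiff.1 hi
    obtain ⟨j, hj⟩ := Finset.card_eq_one.1 (mem_boundary.1 hi)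
    have hmem : ∀ j', j' ∈ T ∧ i ∈ S j' ↔ j' = j := fun j' => by
      simpa using Finset.ext_iff.1 hj j'
    obtain ⟨hjT, hij⟩ := (hmem j).2 rfl
    obtain ⟨x, hxD, hx⟩ := ih (T.erase j) (Finset.erase_ssubset hjT)
      fun T' h => hT T' (h.trans (Finset.erase_subset _ _))
    by_cases hxj : parity (S j) x = c j
    · refine ⟨x, hxD, fun j' hj' => ?_⟩
      by_cases h : j' = j
      · rw [h, hxj]
      · exact hx j' (Finset.mem_erase.2 ⟨h, hj'⟩)
    -- Within `T` the vertex `i` lies on `j` alone, so flipping it repairs constraint `j` and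
    -- disturbs no other.
    · refine ⟨fun i' => xor (x i') (decide (i' = i)), fun i' hi' => ?_, fun j' hj' => ?_⟩
      · have : i' ≠ i := fun h => hiD (h ▸ hi')
        simp [this, hxD i' hi']
      · rw [parity_xor, parity_single]
        by_cases h : j' = j
        · subst h
          rw [if_pos hij]
          have : ∀ a b : ZMod 2, a ≠ b → a + 1 = b := by decide
          exact this _ _ hxj
        · have : i ∉ S j' := fun hi' => h ((hmem j').1 ⟨hj', hi'⟩)
          rw [if_neg this, add_zero]
          exact hx j' (Finset.mem_erase.2 ⟨h, hj'⟩)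

/-- If all sets of constraints have two free boundary variables, the solutions of the system are
balanced in each free variable; hence a linear form is, for one of them, at least as large as
at the point with free coordinates `1/2`. -/
theorem exists_parity_eq_of_two_le [DecidableEq ι] (D : Finset (Fin n)) (c : ι → ZMod 2)
    (x₀ : Fin n → Bool) (T : Finset ι)
    (hT : ∀ T' ⊆ T, T'.Nonempty → 2 ≤ (boundary S T' \ D).card)
    (a : Fin n → ℝ) {V : Finset (Fin n)} (hV : Disjoint D V) :
    ∃ x : Fin n → Bool, (∀ i ∈ D, x i = x₀ i) ∧ (∀ j ∈ T, parity (S j) x = c j) ∧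
      0 ≤ ∑ i ∈ V, a i * (boolPoint x i - 1 / 2) := by
  classical
  let sol : Finset (Fin n → Bool) := Finset.univ.filter fun x =>
    (∀ i ∈ D, x i = x₀ i) ∧ ∀ j ∈ T, parity (S j) x = c j
  have hbal : ∀ i ∉ D, ∑ x ∈ sol, (boolPoint x i - 1 / 2) = 0 := by
    intro i hiD
    -- A homogeneous solution that vanishes on `D` and is 1 at `i`. Fixing `i` as well may use up
    -- one boundary variable, which is why two are required. Adding `w` is an involution of the
    -- solutions that flips coordinate `i`.
    obtain ⟨w, hwD, hw⟩ := exists_parity_eq (S := S) (insert i D) (fun _ => 0)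
      (fun i' => decide (i' = i)) T (fun T' h hne => by
        rw [← Finset.card_pos, Finset.insert_eq, Finset.union_comm, ← Finset.sup_eq_union,
          ← sdiff_sdiff_left]
        have h1 := hT T' h hne
        have h2 := Finset.le_card_sdiff {i} (boundary S T' \ D)
        rw [Finset.card_singleton] at h2
        omega)
    have hwi : w i = true := by simpa using hwD i (Finset.mem_insert_self _ _)
    have hwD' : ∀ i' ∈ D, w i' = false := fun i' hi' => by
      have : i' ≠ i := fun h => hiD (h ▸ hi')
      simpa [this] using hwD i' (Finset.mem_insert_of_mem hi')
    refine Finset.sum_involution (fun x _ i' => xor (x i') (w i')) ?_ ?_ ?_ ?_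
    · intro x _
      cases h : x i <;> norm_num [boolPoint, hwi, h]
    · intro x _ _ h
      have := congrFun h i
      simp [hwi] at this
    · intro x hx
      simp only [sol, Finset.mem_filter, Finset.mem_univ, true_and] at hx ⊢
      refine ⟨fun i' hi' => by simp [hwD' i' hi', hx.1 i' hi'], fun j hj => ?_⟩
      rw [parity_xor, hw j hj, hx.2 j hj, add_zero]
    · intro x _
      ext i'
      simp
  obtain ⟨x, hxD, hx⟩ := exists_parity_eq (S := S) D c x₀ T fun T' h hne =>
    Finset.card_pos.1 (by have := hT T' h hne; omega)
  have hzero : ∑ x ∈ sol, ∑ i ∈ V, a i * (boolPoint x i - 1 / 2) = 0 := by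
    rw [Finset.sum_comm]
    refine Finset.sum_eq_zero fun i hi => ?_
    rw [← Finset.mul_sum, hbal i (Finset.disjoint_right.1 hV hi), mul_zero]
  -- The form sums to zero over the nonempty solution set, so it is nonnegative at some solution.
  obtain ⟨y, hy, hle⟩ := Finset.exists_le_of_sum_le (s := sol) (f := fun _ => (0 : ℝ))
    ⟨x, by simp [sol]; exact ⟨hxD, hx⟩⟩ (by rw [hzero]; simp)
  simp only [sol, Finset.mem_filter, Finset.mem_univ, true_and] at hy
  exact ⟨y, hy.1, hy.2, hle⟩

/-! ### Closures in expanding hypergraphs -/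

variable (S)

/-- All nonempty sets of at most `r` edges have large boundary. -/
def Expanding (r : ℕ) : Prop :=
  ∀ T : Finset ι, T.Nonempty → T.card ≤ r → 7 * T.card ≤ 2 * (boundary S T).card

/-- `J` is maximal among the sets of at most `r` edges with a small boundary outside of `E`. -/
structure IsClosure (r : ℕ) (E : Finset (Fin n)) (J : Finset ι) : Prop where
  card_le : J.card ≤ r
  boundary_le : (boundary S J \ E).card ≤ 3 * J.card
  eq_of_subset : ∀ J', J ⊆ J' → J'.card ≤ r → (boundary S J' \ E).card ≤ 3 * J'.card → J' = J

variable {S}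

theorem exists_isClosure [Fintype ι] {r : ℕ} {E : Finset (Fin n)} {J₀ : Finset ι}
    (h1 : J₀.card ≤ r) (h2 : (boundary S J₀ \ E).card ≤ 3 * J₀.card) :
    ∃ J, J₀ ⊆ J ∧ IsClosure S r E J := by
  classical
  obtain ⟨J, hJ, hmax⟩ := Finset.exists_max_image
    (Finset.univ.filter fun J : Finset ι => J₀ ⊆ J ∧ J.card ≤ r ∧
      (boundary S J \ E).card ≤ 3 * J.card) Finset.card ⟨J₀, by simp [h1, h2]⟩
  simp only [Finset.mem_filter, Finset.mem_univ, true_and] at hJ hmax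
  exact ⟨J, hJ.1, hJ.2.1, hJ.2.2, fun J' h h3 h4 =>
    (Finset.eq_of_subset_of_card_le h (hmax J' ⟨hJ.1.trans h, h3, h4⟩)).symm⟩

/-- The expansion rate 7/2 exceeds the closure threshold 3 by 1/2, and this surplus of boundary must
lie in `E`: `7/2 |J| ≤ |∂J| ≤ 3 |J| + |E|`. -/
theorem IsClosure.card_le_two_mul {r : ℕ} {E : Finset (Fin n)} {J : Finset ι}
    (hJ : IsClosure S r E J) (hS : Expanding S r) : J.card ≤ 2 * E.card := by
  rcases J.eq_empty_or_nonempty with rfl | hne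
  · simp
  have h1 := hS J hne hJ.card_le
  have h2 := hJ.boundary_le
  have h3 := Finset.card_le_card_sdiff_add_card (s := boundary S J) (t := E)
  omega

/-- A boundary vertex of the union that is touched by `J` lies on only one edge of `J`; one not
touched by `J` is a boundary vertex of `T`. -/
theorem boundary_union_sdiff_subset [DecidableEq ι] (E : Finset (Fin n)) (J T : Finset ι) :
    boundary S (J ∪ T) \ E ⊆ (boundary S J \ E) ∪ (boundary S T \ (E ∪ J.biUnion S)) := by
  intro i hi
  obtain ⟨hi, hiE⟩ := Finset.mem_sdiff.1 hi
  rw [mem_boundary, Finset.filter_union] at hi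
  by_cases h : i ∈ J.biUnion S
  · refine Finset.mem_union_left _ (Finset.mem_sdiff.2 ⟨mem_boundary.2 ?_, hiE⟩)
    obtain ⟨j, hj, hij⟩ := Finset.mem_biUnion.1 h
    have h1 : 0 < (J.filter fun j => i ∈ S j).card :=
      Finset.card_pos.2 ⟨j, Finset.mem_filter.2 ⟨hj, hij⟩⟩
    have h2 := Finset.card_le_card (Finset.subset_union_left
      (s₁ := J.filter fun j => i ∈ S j) (s₂ := T.filter fun j => i ∈ S j))
    omega
  · refine Finset.mem_union_right _ (Finset.mem_sdiff.2 ⟨mem_boundary.2 ?_, by simp [hiE, h]⟩)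
    have h1 : (J.filter fun j => i ∈ S j) = ∅ :=
      Finset.filter_eq_empty_iff.2 fun j hj hij => h (Finset.mem_biUnion.2 ⟨j, hj, hij⟩)
    rwa [h1, Finset.empty_union] at hi

/-- Outside of a closure and its variables the hypergraph still expands. -/
theorem IsClosure.lt_card_boundary [DecidableEq ι] {r : ℕ} {E : Finset (Fin n)} {J : Finset ι}
    (hJ : IsClosure S r E J) {T : Finset ι} (hT : T.Nonempty) (hdisj : Disjoint J T)
    (hcard : J.card + T.card ≤ r) :
    3 * T.card < (boundary S T \ (E ∪ J.biUnion S)).card := by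
  by_contra hle
  have h1 := Finset.card_le_card (boundary_union_sdiff_subset (S := S) E J T)
  have h2 := Finset.card_union_le (boundary S J \ E) (boundary S T \ (E ∪ J.biUnion S))
  have h3 := hJ.boundary_le
  have h4 := Finset.card_union_of_disjoint hdisj
  -- Otherwise `J ∪ T` would also qualify and, being strictly larger, contradict the maximality of
  -- `J`.
  have h5 := hJ.eq_of_subset (J ∪ T) Finset.subset_union_left (by omega) (by omega)
  have h6 := Finset.card_pos.2 hT
  rw [h5] at h4
  omega

/-! ### The depth lower bound -/

variable (S)

/-- The halfspace of `L` contains a partially integral point, obtained by fixing `2 * t` variables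
and the variables of the closure of these, such that the constraints of the closure hold. -/
def Reachable (b : ι → ZMod 2) (r t : ℕ) (L : LinIneq n) : Prop :=
  ∃ (E : Finset (Fin n)) (J : Finset ι) (x : Fin n → Bool), E.card ≤ 2 * t ∧ IsClosure S r E J ∧
    (∀ j ∈ J, parity (S j) x = b j) ∧ midPoint (E ∪ J.biUnion S) x ∈ L.halfspace

variable {S}

/-- Restores the invariant after two more variables are fixed: the closure is enlarged, and its new
constraints are solved without lowering the linear form of `L`. -/
theorem reachable_of_extension [Fintype ι] [DecidableEq ι] {b : ι → ZMod 2} {r t : ℕ}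
    (hS : Expanding S r) (hr : 8 * t + 8 ≤ r) {L : LinIneq n} {E A : Finset (Fin n)}
    {J : Finset ι} {x : Fin n → Bool} (hE : E.card ≤ 2 * t) (hJ : IsClosure S r E J)
    (hx : ∀ j ∈ J, parity (S j) x = b j) (hA : A.card ≤ 2)
    (hL : midPoint (E ∪ J.biUnion S ∪ A) x ∈ L.halfspace) :
    Reachable S b r (t + 1) L := by
  have hE' : (E ∪ A).card ≤ 2 * (t + 1) := (Finset.card_union_le _ _).trans (by omega)
  -- Enlarging `E` only shrinks the outer boundary, so `J` still qualifies and can be extended to a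
  -- closure of `E ∪ A`.
  obtain ⟨J', hJJ', hJ'⟩ := exists_isClosure (S := S) (E := E ∪ A) hJ.card_le
    ((Finset.card_le_card (Finset.sdiff_subset_sdiff subset_rfl Finset.subset_union_left)).trans
      hJ.boundary_le)
  have hc := hJ.card_le_two_mul hS
  have hc' := hJ'.card_le_two_mul hS
  set D := E ∪ J.biUnion S ∪ A with hD
  set D' := (E ∪ A) ∪ J'.biUnion S with hD'
  have hDD' : D ⊆ D' := by
    rw [hD, hD', Finset.union_right_comm]
    exact Finset.union_subset_union subset_rfl (Finset.biUnion_subset_biUnion_of_subset_left S hJJ')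
  -- At least four boundary vertices of `T` are free outside `E` and the variables of `J`; the at
  -- most two in `A` leave two. The size condition holds since `|J| ≤ 4t` and `|J'| ≤ 4t + 4`.
  obtain ⟨y, hyD, hy, hle⟩ := exists_parity_eq_of_two_le (S := S) D b x (J' \ J)
    (fun T hT hne => by
      have h1 := hJ.lt_card_boundary (T := T) hne
        (Finset.disjoint_right.2 fun j hj => (Finset.mem_sdiff.1 (hT hj)).2) (by
          have := Finset.card_le_card (hT.trans Finset.sdiff_subset)
          omega)
      have h2 := Finset.card_pos.2 hne
      have h3 := Finset.le_card_sdiff A (boundary S T \ (E ∪ J.biUnion S))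
      rw [sdiff_sdiff_left, Finset.sup_eq_union, ← hD] at h3
      omega)
    L.a (V := D' \ D) Finset.disjoint_sdiff
  refine ⟨E ∪ A, J', y, hE', hJ', fun j hj => ?_, ?_⟩
  · by_cases h : j ∈ J
    · rw [← hx j h]
      refine parity_congr fun i hi => hyD i ?_
      exact Finset.mem_union_left _ (Finset.mem_union_right _ (Finset.mem_biUnion.2 ⟨j, h, hi⟩))
    · exact hy j (Finset.mem_sdiff.2 ⟨hj, h⟩)
  · have h := sum_mul_midPoint_union L.a (D := D) (A := D' \ D) Finset.disjoint_sdiff hyD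
    rw [Finset.union_sdiff_of_subset hDD'] at h
    simp only [LinIneq.halfspace, Set.mem_ofPred_eq] at hL ⊢
    rw [h]
    linarith

theorem Reachable.step [Fintype ι] [DecidableEq ι] {b : ι → ZMod 2} {r t : ℕ}
    (hS : Expanding S r) (hr : 8 * t + 8 ≤ r) {L L₁ L₂ : LinIneq n} (h : Reachable S b r t L)
    (hcov : ∀ y : Fin n → Bool, boolPoint y ∈ L.halfspace →
      boolPoint y ∈ L₁.halfspace ∨ boolPoint y ∈ L₂.halfspace) :
    Reachable S b r (t + 1) L₁ ∨ Reachable S b r (t + 1) L₂ := by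
  obtain ⟨E, J, x, hE, hJ, hx, hL⟩ := h
  obtain ⟨A, -, hA, y, hyD, hy⟩ := exists_midPoint_mem_of_cover hL hcov
  have hyJ : ∀ j ∈ J, parity (S j) y = b j := fun j hj => by
    rw [← hx j hj]
    exact parity_congr fun i hi =>
      hyD i (Finset.mem_union_right _ (Finset.mem_biUnion.2 ⟨j, hj, hi⟩))
  exact hy.imp (reachable_of_extension hS hr hE hJ hyJ hA)
    (reachable_of_extension hS hr hE hJ hyJ hA)

/-- A reachable halfspace contains a Boolean point that satisfies a given constraint. -/
theorem Reachable.exists_boolPoint [DecidableEq ι] {b : ι → ZMod 2} {r t : ℕ}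
    (hS : Expanding S r) (hr : 8 * t + 8 ≤ r) {L : LinIneq n} (h : Reachable S b r t L) (j : ι) :
    ∃ y : Fin n → Bool, boolPoint y ∈ L.halfspace ∧ parity (S j) y = b j := by
  obtain ⟨E, J, x, hE, hJ, hx, hL⟩ := h
  have hc := hJ.card_le_two_mul hS
  set D := E ∪ J.biUnion S with hD
  -- The system `{j} \ J` is empty when `j` is already satisfied through the closure, so both cases
  -- are treated at once.
  obtain ⟨y, hyD, hy, hle⟩ := exists_parity_eq_of_two_le (S := S) D b x ({j} \ J)
    (fun T hT hne => by
      have h1 := hJ.lt_card_boundary (T := T) hne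
        (Finset.disjoint_right.2 fun j hj => (Finset.mem_sdiff.1 (hT hj)).2) (by
          have := Finset.card_le_card (hT.trans Finset.sdiff_subset)
          rw [Finset.card_singleton] at this
          omega)
      have h2 := Finset.card_pos.2 hne
      rw [← hD] at h1
      omega)
    L.a (V := Dᶜ) disjoint_compl_right
  refine ⟨y, ?_, ?_⟩
  · have h := sum_mul_midPoint_union L.a (D := D) (A := Dᶜ) disjoint_compl_right hyD
    rw [Finset.union_compl, midPoint_univ] at h
    simp only [LinIneq.halfspace, Set.mem_ofPred_eq] at hL ⊢
    rw [h]
    linarith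
  · by_cases hj : j ∈ J
    · rw [← hx j hj]
      exact parity_congr fun i hi =>
        hyD i (Finset.mem_union_right _ (Finset.mem_biUnion.2 ⟨j, hj, hi⟩))
    · exact hy j (by simp [hj])

theorem exists_two_children {α : Type*} {s : Set α} (hs : s.encard ≤ 2) (hne : s.Nonempty) :
    ∃ u ∈ s, ∃ v ∈ s, ∀ w ∈ s, w = u ∨ w = v := by
  obtain ⟨u, hu⟩ := hne
  have h1 : (s \ {u}).encard ≤ 1 := by
    have := Set.encard_sdiff_singleton_add_one hu
    have h2 : (s \ {u}).encard + 1 ≤ 1 + 1 := by rw [this]; simpa [one_add_one_eq_two] using hs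
    exact (ENat.add_le_add_iff_right (by simp)).1 h2
  rcases (s \ {u}).eq_empty_or_nonempty with h | ⟨v, hv⟩
  · exact ⟨u, hu, u, hu, fun w hw => Or.inl (by
      by_contra hne
      exact (Set.eq_empty_iff_forall_notMem.1 h) w ⟨hw, hne⟩)⟩
  · refine ⟨u, hu, v, hv.1, fun w hw => ?_⟩
    by_cases hwu : w = u
    · exact Or.inl hwu
    · exact Or.inr (Set.encard_le_one_iff.1 h1 w v ⟨hw, hwu⟩ hv)

/-- A reachable node is never a leaf: it contains a Boolean point satisfying the constraint that
implies the clause the leaf would falsify. -/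
theorem Refutation.exists_path [Fintype ι] [DecidableEq ι] {F : CNF n} (π : Refutation F)
    (b : ι → ZMod 2)
    (hF : ∀ C ∈ F, ∃ j, ∀ x : Fin n → Bool, parity (S j) x = b j → Clause.Sat C x)
    {r : ℕ} (hS : Expanding S r) (t : ℕ) (ht : 8 * t ≤ r) :
    ∃ p : Fin (t + 1) → Fin π.size, (∀ i : Fin t, π.edge (p i.castSucc) (p i.succ)) ∧
      Reachable S b r t (π.label (p (Fin.last t))) := by
  induction t with
  | zero =>
    refine ⟨fun _ => π.root, fun i => i.elim0, ?_⟩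
    -- The closure of the empty set is empty, so the walk starts at the centre of the cube.
    obtain ⟨J, -, hJ⟩ := exists_isClosure (S := S) (r := r) (E := ∅) (J₀ := ∅) (by simp)
      (by simp [boundary])
    have h0 : J = ∅ := by simpa using hJ.card_le_two_mul hS
    exact ⟨∅, J, fun _ => false, by simp, hJ, by simp [h0], by rw [π.root_label]; trivial⟩
  | succ t ih =>
    obtain ⟨p, hp, hreach⟩ := ih (by omega)
    have hint : ∃ v, π.edge (p (Fin.last t)) v := by
      by_contra hno
      obtain ⟨C, hC, hfalse⟩ := π.leaf _ (not_exists.1 hno)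
      obtain ⟨j, hj⟩ := hF C hC
      obtain ⟨y, hy, hyj⟩ := hreach.exists_boolPoint hS (by omega) j
      exact hfalse y hy (hj y hyj)
    obtain ⟨v₁, hv₁, v₂, hv₂, hv⟩ := exists_two_children (π.fanout_le_two (p (Fin.last t))) hint
    have hstep := hreach.step hS (by omega) (L₁ := π.label v₁) (L₂ := π.label v₂) fun y hy => by
      obtain ⟨v, hev, hyv⟩ := π.internal _ hint y hy
      rcases hv v hev with rfl | rfl
      · exact Or.inl hyv
      · exact Or.inr hyv
    obtain ⟨v, hev, hreach'⟩ : ∃ v, π.edge (p (Fin.last t)) v ∧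
        Reachable S b r (t + 1) (π.label v) := by
      rcases hstep with h | h
      · exact ⟨v₁, hv₁, h⟩
      · exact ⟨v₂, hv₂, h⟩
    refine ⟨Fin.snoc (α := fun _ => Fin π.size) p v, fun i => ?_, ?_⟩
    · induction i using Fin.lastCases with
      | last =>
        rw [Fin.succ_last, Fin.snoc_last, Fin.snoc_castSucc]
        exact hev
      | cast i =>
        rw [← Fin.castSucc_succ, Fin.snoc_castSucc, Fin.snoc_castSucc]
        exact hp i
    · rw [Fin.snoc_last]
      exact hreach'

/-- A formula whose clauses follow from parity constraints on an expanding hypergraph requires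
large depth. -/
theorem le_depthSCP_of_expanding [Fintype ι] [DecidableEq ι] {F : CNF n} (b : ι → ZMod 2)
    (hF : ∀ C ∈ F, ∃ j, ∀ x : Fin n → Bool, parity (S j) x = b j → Clause.Sat C x)
    {r : ℕ} (hS : Expanding S r) {t : ℕ} (ht : 8 * t ≤ r) : (t : ℕ∞) ≤ depthSCP F := by
  refine le_iInf fun π => ?_
  obtain ⟨p, hp, -⟩ := π.exists_path b hF hS t ht
  exact le_iSup₂_of_le t ⟨p, hp⟩ le_rfl

end Hypergraph

/-! ### Uniform probability -/

theorem uniformProb_nonneg {Ω : Type} [Fintype Ω] (A : Set Ω) : 0 ≤ uniformProb A := by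
  unfold uniformProb; positivity

theorem uniformProb_mono {Ω : Type} [Fintype Ω] {A B : Set Ω} (h : A ⊆ B) :
    uniformProb A ≤ uniformProb B := by
  unfold uniformProb
  gcongr
  exact B.toFinite

theorem uniformProb_le_one {Ω : Type} [Fintype Ω] (A : Set Ω) : uniformProb A ≤ 1 := by
  unfold uniformProb
  refine div_le_one_of_le₀ ?_ (by positivity)
  rw [← Nat.card_eq_fintype_card]
  exact_mod_cast Set.ncard_le_card A

theorem uniformProb_biUnion_le {Ω κ : Type} [Fintype Ω] (s : Finset κ) (A : κ → Set Ω) :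
    uniformProb (⋃ i ∈ s, A i) ≤ ∑ i ∈ s, uniformProb (A i) := by
  unfold uniformProb
  rw [← Finset.sum_div]
  gcongr
  exact_mod_cast Finset.set_ncard_biUnion_le s A

theorem one_sub_le_uniformProb {Ω : Type} [Fintype Ω] [Nonempty Ω] {A B C : Set Ω}
    (h : ∀ ω, ω ∉ B → ω ∉ C → ω ∈ A) : 1 - uniformProb B - uniformProb C ≤ uniformProb A := by
  have hcard : (0 : ℝ) < Fintype.card Ω := by exact_mod_cast Fintype.card_pos
  have h1 : Fintype.card Ω ≤ A.ncard + B.ncard + C.ncard := by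
    have h2 : (Set.univ : Set Ω) = A ∪ B ∪ C := by
      ext ω
      have := h ω
      simp only [Set.mem_univ, Set.mem_union, true_iff]
      tauto
    rw [← Nat.card_eq_fintype_card, ← Set.ncard_univ, h2]
    exact (Set.ncard_union_le _ _).trans (Nat.add_le_add_right (Set.ncard_union_le _ _) _)
  have h3 : (Fintype.card Ω : ℝ) ≤ A.ncard + B.ncard + C.ncard := by exact_mod_cast h1
  unfold uniformProb
  rw [sub_sub, ← add_div, sub_le_iff_le_add, ← add_div, le_div_iff₀ hcard]
  linarith

theorem uniformProb_pi {α : Type} [Fintype α] [Nonempty α] {m : ℕ} (T : Finset (Fin m))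
    (B : Set α) :
    uniformProb {E : Fin m → α | ∀ j ∈ T, E j ∈ B} = uniformProb B ^ T.card := by
  classical
  have hcard : (Fintype.card α : ℝ) ≠ 0 := by exact_mod_cast Fintype.card_ne_zero
  have h1 : {E : Fin m → α | ∀ j ∈ T, E j ∈ B} =
      (Fintype.piFinset fun j => if j ∈ T then B.toFinset else Finset.univ :
        Finset (Fin m → α)) := by
    ext E
    simp only [Set.mem_ofPred_eq, Finset.mem_coe, Fintype.mem_piFinset]
    refine forall_congr' fun j => ?_
    by_cases hj : j ∈ T <;> simp [hj]
  have h2 : ∀ j : Fin m, ((if j ∈ T then B.toFinset else Finset.univ : Finset α).card : ℝ) /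
      Fintype.card α = if j ∈ T then uniformProb B else 1 := by
    intro j
    by_cases hj : j ∈ T
    · simp [hj, uniformProb, Set.ncard_eq_toFinset_card']
    · simp [hj, hcard]
  rw [h1]
  unfold uniformProb at h2 ⊢
  rw [Set.ncard_coe_finset, Fintype.card_piFinset, Fintype.card_fun, Fintype.card_fin]
  push_cast
  have h3 : (Fintype.card α : ℝ) ^ m = ∏ _j : Fin m, (Fintype.card α : ℝ) := by simp
  rw [h3, ← Finset.prod_div_distrib, Finset.prod_congr rfl fun j _ => h2 j, Finset.prod_ite_mem]
  simp [div_pow]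

/-! ### Numerical estimates -/

/-- Factor by factor, `(w - i) / (n - i) ≤ w / n`. -/
theorem descFactorial_mul_pow_le {w n : ℕ} (h : w ≤ n) (k : ℕ) :
    w.descFactorial k * n ^ k ≤ n.descFactorial k * w ^ k := by
  induction k with
  | zero => simp
  | succ k ih =>
    have h1 : (w - k) * n ≤ (n - k) * w := by
      rw [Nat.sub_mul, Nat.sub_mul, Nat.mul_comm n w]
      exact Nat.sub_le_sub_left (Nat.mul_le_mul_left k h) _
    calc w.descFactorial (k + 1) * n ^ (k + 1)
        = ((w - k) * n) * (w.descFactorial k * n ^ k) := by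
          rw [Nat.descFactorial_succ, pow_succ]; ring
      _ ≤ ((n - k) * w) * (n.descFactorial k * w ^ k) := Nat.mul_le_mul h1 ih
      _ = n.descFactorial (k + 1) * w ^ (k + 1) := by
          rw [Nat.descFactorial_succ, pow_succ]; ring

theorem choose_div_choose_le {w n k : ℕ} (h : w ≤ n) (hk : k ≤ n) :
    (w.choose k : ℝ) / n.choose k ≤ ((w : ℝ) / n) ^ k := by
  rcases Nat.eq_zero_or_pos n with rfl | hn
  · obtain rfl : k = 0 := by omega
    simp
  have h1 := descFactorial_mul_pow_le h k
  rw [Nat.descFactorial_eq_factorial_mul_choose, Nat.descFactorial_eq_factorial_mul_choose,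
    mul_assoc, mul_assoc] at h1
  have h2 := Nat.le_of_mul_le_mul_left h1 (Nat.factorial_pos k)
  have h3 : (0 : ℝ) < n.choose k := by exact_mod_cast Nat.choose_pos hk
  rw [div_pow, div_le_div_iff₀ h3 (by positivity), mul_comm ((w : ℝ) ^ k)]
  exact_mod_cast h2

theorem choose_mul_pow_le (n w : ℕ) :
    (n.choose w : ℝ) * (w : ℝ) ^ w ≤ Real.exp w * (n : ℝ) ^ w := by
  have hf : (0 : ℝ) < w.factorial := by exact_mod_cast w.factorial_pos
  have h1 : (n.choose w : ℝ) ≤ (n : ℝ) ^ w / w.factorial := Nat.choose_le_pow_div w n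
  have h2 := Real.pow_div_factorial_le_exp w (by positivity) w
  calc (n.choose w : ℝ) * (w : ℝ) ^ w ≤ (n : ℝ) ^ w / w.factorial * (w : ℝ) ^ w := by gcongr
    _ = (w : ℝ) ^ w / w.factorial * (n : ℝ) ^ w := by ring
    _ ≤ Real.exp w * (n : ℝ) ^ w := by gcongr

/-- The number of vertices that `s` edges of size `k` must span for their boundary to be large. -/
def spanBound (k s : ℕ) : ℕ := (k - 1) * s - (s + 3) / 4

theorem spanBound_add {k s : ℕ} (hk : 6 ≤ k) : spanBound k s + s + (s + 3) / 4 = k * s := by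
  obtain ⟨l, rfl⟩ : ∃ l, k = l + 6 := ⟨k - 6, by omega⟩
  have h1 : (l + 6 - 1) * s = l * s + 5 * s := by
    rw [show l + 6 - 1 = l + 5 by omega]; ring
  have h2 : (l + 6) * s = l * s + 6 * s := by ring
  unfold spanBound
  rw [h1, h2]
  omega

/-- The terms of the union bound for the failure of expansion decay geometrically. -/
theorem union_bound_term_le {k N n s : ℕ} (hk : 6 ≤ k) (hn : 0 < n) :
    ((N * n).choose s : ℝ) * n.choose (spanBound k s) *
        ((spanBound k s : ℝ) / n) ^ (k * s) ≤
      (Real.exp (k + 1) * k * N) ^ s * ((k * s : ℝ) / n) ^ ((s + 3) / 4) := by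
  set w := spanBound k s with hw
  set q := (s + 3) / 4 with hq
  -- The exponent `k * s` is split in three: `w` factors absorb the choice of vertices, `s` factors
  -- the choice of edges, and the remaining `q ≥ s / 4` make the term small.
  have hsum : w + s + q = k * s := spanBound_add hk
  have hn' : (0 : ℝ) < n := by exact_mod_cast hn
  have hwk : (w : ℝ) ≤ k * s := by
    have : w ≤ k * s := by omega
    exact_mod_cast this
  have h1 : (n.choose w : ℝ) * ((w : ℝ) / n) ^ w ≤ Real.exp (k * s) := by
    rw [div_pow, ← mul_div_assoc, div_le_iff₀ (by positivity)]
    refine (choose_mul_pow_le n w).trans ?_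
    gcongr
  have h2 : ((N * n).choose s : ℝ) * ((w : ℝ) / n) ^ s ≤ (Real.exp 1 * k * N) ^ s := by
    calc ((N * n).choose s : ℝ) * ((w : ℝ) / n) ^ s
        ≤ ((N * n).choose s : ℝ) * ((k * s : ℝ) / n) ^ s := by gcongr
      _ = ((N * n).choose s * (s : ℝ) ^ s) * ((k : ℝ) / n) ^ s := by
          rw [div_pow, div_pow, mul_pow]; ring
      _ ≤ (Real.exp s * ((N * n : ℕ) : ℝ) ^ s) * ((k : ℝ) / n) ^ s := by
          gcongr ?_ * _
          exact choose_mul_pow_le _ _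
      _ = (Real.exp 1 * k * N) ^ s := by
          rw [← Real.exp_one_pow, ← mul_pow, ← mul_pow]
          congr 1
          push_cast
          field_simp
  have h3 : ((w : ℝ) / n) ^ q ≤ ((k * s : ℝ) / n) ^ q := by gcongr
  calc ((N * n).choose s : ℝ) * n.choose w * ((w : ℝ) / n) ^ (k * s)
      = (n.choose w * ((w : ℝ) / n) ^ w) * ((N * n).choose s * ((w : ℝ) / n) ^ s) *
          ((w : ℝ) / n) ^ q := by rw [← hsum, pow_add, pow_add]; ring
    _ ≤ Real.exp (k * s) * (Real.exp 1 * k * N) ^ s * ((k * s : ℝ) / n) ^ q := by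
        gcongr
    _ = (Real.exp (k + 1) * k * N) ^ s * ((k * s : ℝ) / n) ^ q := by
        congr 1
        rw [mul_comm (k : ℝ) s, Real.exp_nat_mul, ← mul_pow, Real.exp_add]
        ring

/-- Dominated convergence: each term with `s ≥ 1` tends to 0, and since `4 * ((s + 3) / 4) ≥ s`, the
choice of `γ` bounds it by `(1 / 2) ^ s`. -/
theorem tendsto_sum_union_bound {k : ℕ} {A γ : ℝ} (hA : 1 ≤ A) (hγ : 0 < γ)
    (hγA : k * γ ≤ (1 / (2 * A)) ^ 4) :
    Tendsto (fun n : ℕ => ∑ s ∈ Finset.Icc 1 ⌊γ * n⌋₊, A ^ s * ((k * s : ℝ) / n) ^ ((s + 3) / 4))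
      atTop (𝓝 0) := by
  let f : ℕ → ℕ → ℝ := fun n s =>
    if s ∈ Finset.Icc 1 ⌊γ * n⌋₊ then A ^ s * ((k * s : ℝ) / n) ^ ((s + 3) / 4) else 0
  have hA0 : 0 < A := by linarith
  have hf : ∀ n s, 0 ≤ f n s := by
    intro n s
    simp only [f]
    split_ifs
    · positivity
    · exact le_rfl
  have hsum : ∀ n : ℕ, ∑ s ∈ Finset.Icc 1 ⌊γ * n⌋₊, A ^ s * ((k * s : ℝ) / n) ^ ((s + 3) / 4) =
      ∑' s, f n s := by
    intro n
    rw [tsum_eq_sum (s := Finset.Icc 1 ⌊γ * n⌋₊) fun s hs => if_neg hs]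
    exact Finset.sum_congr rfl fun s hs => (if_pos hs).symm
  simp only [hsum]
  have key := tendsto_tsum_of_dominated_convergence (𝓕 := atTop) (f := f) (g := fun _ => (0 : ℝ))
    (bound := fun s : ℕ => (1 / 2 : ℝ) ^ s) summable_geometric_two ?_ ?_
  · simpa using key
  · intro s
    rcases Nat.eq_zero_or_pos s with rfl | hs
    · simp [f]
    have h1 : Tendsto (fun n : ℕ => A ^ s * ((k * s : ℝ) / n) ^ ((s + 3) / 4)) atTop (𝓝 0) := by
      have h2 := ((tendsto_const_div_atTop_nhds_zero_nat (k * s : ℝ)).pow ((s + 3) / 4)).const_mul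
        (A ^ s)
      rwa [zero_pow (by omega), mul_zero] at h2
    refine squeeze_zero (fun n => hf n s) (fun n => ?_) h1
    simp only [f]
    split_ifs
    · exact le_rfl
    · positivity
  · refine Eventually.of_forall fun n s => ?_
    rw [Real.norm_of_nonneg (hf n s)]
    simp only [f]
    split_ifs with hs
    · obtain ⟨hs1, hs2⟩ := Finset.mem_Icc.1 hs
      have hγn : (s : ℝ) ≤ γ * n := (Nat.le_floor_iff (by positivity)).1 hs2
      have hn : (0 : ℝ) < n := by
        have : (1 : ℝ) ≤ s := by exact_mod_cast hs1
        by_contra h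
        have : (n : ℝ) = 0 := le_antisymm (not_lt.1 h) (by positivity)
        rw [this, mul_zero] at hγn
        linarith
      have h1 : (k * s : ℝ) / n ≤ (1 / (2 * A)) ^ 4 := by
        refine le_trans ?_ hγA
        rw [div_le_iff₀ hn, mul_assoc]
        gcongr
      have h2 : 1 / (2 * A) ≤ 1 := by rw [div_le_one (by positivity)]; linarith
      calc A ^ s * ((k * s : ℝ) / n) ^ ((s + 3) / 4)
          ≤ A ^ s * ((1 / (2 * A)) ^ 4) ^ ((s + 3) / 4) := by gcongr
        _ ≤ A ^ s * (1 / (2 * A)) ^ s := by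
            rw [← pow_mul]
            gcongr A ^ s * ?_
            exact pow_le_pow_of_le_one (by positivity) h2 (by omega)
        _ = (1 / 2) ^ s := by
            rw [← mul_pow]
            congr 1
            field_simp
    · positivity

/-! ### Random hypergraphs -/

/-- Double counting of incidences: a covered vertex outside the boundary lies on at least two edges.
-/
theorem two_mul_card_biUnion_le {n : ℕ} {ι : Type*} {S : ι → Finset (Fin n)} {k : ℕ}
    (hS : ∀ j, (S j).card = k) (T : Finset ι) :
    2 * (T.biUnion S).card ≤ k * T.card + (boundary S T).card := by
  have h1 := Finset.sum_card_bipartiteAbove_eq_sum_card_bipartiteBelow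
    (fun (i : Fin n) (j : ι) => i ∈ S j) (s := T.biUnion S) (t := T)
  have h2 : ∑ j ∈ T, (Finset.bipartiteBelow (fun (i : Fin n) (j : ι) => i ∈ S j)
      (T.biUnion S) j).card = k * T.card := by
    rw [Finset.sum_congr rfl (g := fun _ => k), Finset.sum_const, smul_eq_mul, mul_comm]
    intro j hj
    rw [← hS j]
    congr 1
    ext i
    simp only [Finset.bipartiteBelow, Finset.mem_filter, Finset.mem_biUnion, and_iff_right_iff_imp]
    exact fun hi => ⟨j, hj, hi⟩
  have h3 : ∑ i ∈ T.biUnion S, 2 ≤ ∑ i ∈ T.biUnion S,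
      ((Finset.bipartiteAbove (fun (i : Fin n) (j : ι) => i ∈ S j) T i).card +
        if i ∈ boundary S T then 1 else 0) := by
    refine Finset.sum_le_sum fun i hi => ?_
    obtain ⟨j, hj, hij⟩ := Finset.mem_biUnion.1 hi
    have hpos : 0 < (T.filter fun j => i ∈ S j).card :=
      Finset.card_pos.2 ⟨j, Finset.mem_filter.2 ⟨hj, hij⟩⟩
    simp only [Finset.bipartiteAbove, mem_boundary]
    split_ifs <;> omega
  rw [Finset.sum_add_distrib, h1, h2, Finset.sum_const, smul_eq_mul, Finset.sum_ite_mem,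
    Finset.sum_const, smul_eq_mul, mul_one, mul_comm] at h3
  exact h3.trans (Nat.add_le_add_left (Finset.card_le_card Finset.inter_subset_right) _)

/-- Edges whose boundary is not large are contained in a small set of vertices. -/
theorem exists_small_span_of_not_expanding {n : ℕ} {ι : Type*} {S : ι → Finset (Fin n)} {k r : ℕ}
    (hk : 6 ≤ k) (hS : ∀ j, (S j).card = k) (hr : k * r ≤ n) (h : ¬ Expanding S r) :
    ∃ T : Finset ι, T.card ∈ Finset.Icc 1 r ∧
      ∃ W : Finset (Fin n), W.card = spanBound k T.card ∧ ∀ j ∈ T, S j ⊆ W := by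
  unfold Expanding at h
  push Not at h
  obtain ⟨T, hne, hTr, hT⟩ := h
  have h1 := two_mul_card_biUnion_le hS T
  have h2 := spanBound_add (s := T.card) hk
  have h3 : 6 * T.card ≤ k * T.card := Nat.mul_le_mul_right _ hk
  have h4 : k * T.card ≤ k * r := Nat.mul_le_mul_left _ hTr
  -- Failed expansion gives a span below `ks/2 + 7s/4`, which for `k ≥ 6` is at most `(k - 1)s -
  -- s/4`; this is where `spanBound` comes from. Padding to this exact size, possible since `k * r ≤
  -- n`, makes the sets easy to count.
  obtain ⟨W, hW, hWc⟩ := Finset.exists_superset_card_eq (s := T.biUnion S)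
    (n := spanBound k T.card) (by omega) (by rw [Fintype.card_fin]; omega)
  exact ⟨T, Finset.mem_Icc.2 ⟨Finset.card_pos.2 hne, hTr⟩, W, hWc, fun j hj =>
    (Finset.subset_biUnion_of_mem S hj).trans hW⟩

/-- A type of constraints on `k` of the variables `x₀, …, xₙ₋₁`, with the same number `N` of
constraints on each `k`-element set of variables, not all satisfied by one assignment. -/
structure ConstraintFamily (n k N : ℕ) (α : Type) [Fintype α] where
  vars : α → Finset (Fin n)
  sat : α → (Fin n → Bool) → Prop
  card_vars : ∀ a, (vars a).card = k
  card_fiber : ∀ s : Finset (Fin n), s.card = k → (Finset.univ.filter fun a => vars a = s).card = N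
  exists_not_sat : ∀ (x : Fin n → Bool) (s : Finset (Fin n)), s.card = k →
    ∃ a, vars a = s ∧ ¬ sat a x

namespace ConstraintFamily

variable {n k N : ℕ} {α : Type} [Fintype α]

theorem card_vars_subset (M : ConstraintFamily n k N α) (W : Finset (Fin n)) :
    {a | M.vars a ⊆ W}.ncard = N * W.card.choose k := by
  classical
  rw [Set.ncard_eq_toFinset_card', Finset.card_eq_sum_card_fiberwise (f := M.vars)
    (t := Finset.powersetCard k W) fun a ha => by
      simpa [Finset.mem_powersetCard, M.card_vars] using ha]
  rw [Finset.sum_congr rfl (g := fun _ => N), Finset.sum_const, Finset.card_powersetCard,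
    smul_eq_mul, mul_comm]
  intro s hs
  obtain ⟨hsW, hsk⟩ := Finset.mem_powersetCard.1 hs
  refine Eq.trans ?_ (M.card_fiber s hsk)
  congr 1
  ext a
  simp only [Finset.mem_filter, Set.mem_toFinset, Set.mem_ofPred_eq, Finset.mem_univ, true_and,
    and_iff_right_iff_imp]
  rintro rfl
  exact hsW

theorem card_eq (M : ConstraintFamily n k N α) : Fintype.card α = N * n.choose k := by
  have := M.card_vars_subset Finset.univ
  simpa [Set.ncard_univ, Nat.card_eq_fintype_card] using this

theorem choose_le_card_not_sat (M : ConstraintFamily n k N α) (x : Fin n → Bool) :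
    n.choose k ≤ {a | ¬ M.sat a x}.ncard := by
  choose f hf using fun s : {s : Finset (Fin n) // s.card = k} => M.exists_not_sat x s.1 s.2
  have hinj : Function.Injective f := fun s t h => Subtype.ext (by
    rw [← (hf s).1, ← (hf t).1, h])
  have h1 : (Set.range f).ncard = n.choose k := by
    rw [← Set.image_univ, Set.ncard_image_of_injective _ hinj, Set.ncard_univ,
      Nat.card_eq_fintype_card, Fintype.card_finset_len, Fintype.card_fin]
  rw [← h1]
  refine Set.ncard_le_ncard ?_ (Set.toFinite _)
  rintro _ ⟨s, rfl⟩
  exact (hf s).2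

theorem uniformProb_vars_subset_le (M : ConstraintFamily n k N α) (hN : 0 < N) (hkn : k ≤ n)
    (W : Finset (Fin n)) :
    uniformProb {a | M.vars a ⊆ W} ≤ ((W.card : ℝ) / n) ^ k := by
  unfold uniformProb
  have hN' : (N : ℝ) ≠ 0 := by positivity
  rw [M.card_vars_subset, M.card_eq]
  push_cast
  rw [mul_div_mul_left _ _ hN']
  exact choose_div_choose_le (by simpa using Finset.card_le_univ W) hkn

theorem uniformProb_sat_le (M : ConstraintFamily n k N α) (hN : 0 < N) (hkn : k ≤ n)
    (x : Fin n → Bool) :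
    uniformProb {a | M.sat a x} ≤ 1 - 1 / N := by
  have h1 := M.choose_le_card_not_sat x
  have h2 : {a | M.sat a x}.ncard + {a | ¬ M.sat a x}.ncard = N * n.choose k := by
    rw [← M.card_eq, ← Nat.card_eq_fintype_card]
    exact Set.ncard_add_ncard_compl {a | M.sat a x}
  have h3 : (0 : ℝ) < n.choose k := by exact_mod_cast Nat.choose_pos hkn
  have hN' : (0 : ℝ) < N := by exact_mod_cast hN
  have h4 : ({a | M.sat a x}.ncard : ℝ) + n.choose k ≤ N * n.choose k := by
    have : {a | M.sat a x}.ncard + n.choose k ≤ N * n.choose k := by omega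
    exact_mod_cast this
  unfold uniformProb
  rw [M.card_eq]
  push_cast
  rw [div_le_iff₀ (by positivity)]
  have h5 : (1 - 1 / (N : ℝ)) * (N * n.choose k) = N * n.choose k - n.choose k := by
    field_simp
  linarith

theorem nonempty (M : ConstraintFamily n k N α) (hN : 0 < N) (hkn : k ≤ n) : Nonempty α := by
  rw [← Fintype.card_pos_iff, M.card_eq]
  exact Nat.mul_pos hN (Nat.choose_pos hkn)

/-- A fixed assignment violates a random constraint with probability at least `1 / N`, so it
survives `N * n` of them with probability at most `exp (-n)`; there are `2 ^ n` assignments. -/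
theorem uniformProb_exists_sat_le (M : ConstraintFamily n k N α) (hN : 0 < N) (hkn : k ≤ n) :
    uniformProb {E : Fin (N * n) → α | ∃ x, ∀ j, M.sat (E j) x} ≤ (2 / Real.exp 1) ^ n := by
  have := M.nonempty hN hkn
  have hN' : (0 : ℝ) < N := by exact_mod_cast hN
  have h1 : {E : Fin (N * n) → α | ∃ x, ∀ j, M.sat (E j) x} ⊆
      ⋃ x ∈ (Finset.univ : Finset (Fin n → Bool)),
        {E : Fin (N * n) → α | ∀ j ∈ (Finset.univ : Finset (Fin (N * n))),
          E j ∈ {a | M.sat a x}} := by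
    rintro E ⟨x, hx⟩
    simp only [Set.mem_iUnion]
    exact ⟨x, Finset.mem_univ _, fun j _ => hx j⟩
  have h2 : ∀ x : Fin n → Bool, uniformProb {E : Fin (N * n) → α |
      ∀ j ∈ (Finset.univ : Finset (Fin (N * n))), E j ∈ {a | M.sat a x}} ≤ Real.exp (-n) := by
    intro x
    rw [uniformProb_pi, Finset.card_univ, Fintype.card_fin]
    have h3 : uniformProb {a | M.sat a x} ≤ Real.exp (-(1 / N)) :=
      (M.uniformProb_sat_le hN hkn x).trans (by
        have := Real.add_one_le_exp (-(1 / N : ℝ)); linarith)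
    refine (pow_le_pow_left₀ (uniformProb_nonneg _) h3 _).trans (le_of_eq ?_)
    rw [← Real.exp_nat_mul]
    congr 1
    push_cast
    field_simp
  refine (uniformProb_mono h1).trans ((uniformProb_biUnion_le _ _).trans ?_)
  refine (Finset.sum_le_sum fun x _ => h2 x).trans (le_of_eq ?_)
  simp only [Finset.sum_const, Finset.card_univ, Fintype.card_fun, Fintype.card_bool,
    Fintype.card_fin, nsmul_eq_mul]
  rw [div_pow, Real.exp_one_pow, Real.exp_neg]
  push_cast
  rfl

theorem uniformProb_not_expanding_le (M : ConstraintFamily n k N α) (hk : 6 ≤ k) (hN : 0 < N)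
    (hkn : k ≤ n) {r : ℕ} (hr : k * r ≤ n) :
    uniformProb {E : Fin (N * n) → α | ¬ Expanding (fun j => M.vars (E j)) r} ≤
      ∑ s ∈ Finset.Icc 1 r,
        (Real.exp (k + 1) * k * N) ^ s * ((k * s : ℝ) / n) ^ ((s + 3) / 4) := by
  have := M.nonempty hN hkn
  let P : ℕ → Finset (Finset (Fin (N * n)) × Finset (Fin n)) := fun s =>
    Finset.powersetCard s Finset.univ ×ˢ Finset.powersetCard (spanBound k s) Finset.univ
  have h1 : {E : Fin (N * n) → α | ¬ Expanding (fun j => M.vars (E j)) r} ⊆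
      ⋃ s ∈ Finset.Icc 1 r, ⋃ p ∈ P s,
        {E : Fin (N * n) → α | ∀ j ∈ p.1, E j ∈ {a | M.vars a ⊆ p.2}} := by
    intro E hE
    obtain ⟨T, hT, W, hW, hTW⟩ := exists_small_span_of_not_expanding hk
      (fun j => M.card_vars (E j)) hr hE
    simp only [Set.mem_iUnion]
    exact ⟨T.card, hT, (T, W), by simp [P, Finset.mem_powersetCard, hW], hTW⟩
  refine (uniformProb_mono h1).trans ((uniformProb_biUnion_le _ _).trans ?_)
  refine Finset.sum_le_sum fun s _ => (uniformProb_biUnion_le _ _).trans ?_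
  refine le_trans ?_ (union_bound_term_le hk (by omega))
  calc ∑ p ∈ P s, uniformProb {E : Fin (N * n) → α | ∀ j ∈ p.1, E j ∈ {a | M.vars a ⊆ p.2}}
      ≤ ∑ p ∈ P s, ((spanBound k s : ℝ) / n) ^ (k * s) := by
        refine Finset.sum_le_sum fun p hp => ?_
        obtain ⟨hp1, hp2⟩ := Finset.mem_product.1 hp
        have hc1 := (Finset.mem_powersetCard.1 hp1).2
        have hc2 := (Finset.mem_powersetCard.1 hp2).2
        rw [uniformProb_pi, hc1, pow_mul, ← hc2]
        exact pow_le_pow_left₀ (uniformProb_nonneg _) (M.uniformProb_vars_subset_le hN hkn _) _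
    _ = ((N * n).choose s : ℝ) * n.choose (spanBound k s) *
          ((spanBound k s : ℝ) / n) ^ (k * s) := by
        rw [Finset.sum_const, Finset.card_product, Finset.card_powersetCard,
          Finset.card_powersetCard, Finset.card_univ, Finset.card_univ, Fintype.card_fin,
          Fintype.card_fin, nsmul_eq_mul]
        push_cast
        rfl

end ConstraintFamily

/-- A random list of `N * n` constraints is, with high probability, unsatisfiable and has an
expanding hypergraph of variables. -/
theorem exists_tendsto_uniformProb_expanding {k N : ℕ} (hk : 6 ≤ k) (hN : 0 < N) {α : ℕ → Type}
    [∀ n, Fintype (α n)] (M : ∀ n, ConstraintFamily n k N (α n)) :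
    ∃ γ : ℝ, 0 < γ ∧ Tendsto (fun n : ℕ => uniformProb {E : Fin (N * n) → α n |
      (∀ x, ∃ j, ¬ (M n).sat (E j) x) ∧ Expanding (fun j => (M n).vars (E j)) ⌊γ * n⌋₊})
      atTop (𝓝 1) := by
  set A : ℝ := Real.exp (k + 1) * k * N with hA
  have hk' : (6 : ℝ) ≤ k := by exact_mod_cast hk
  have hN' : (1 : ℝ) ≤ N := by exact_mod_cast hN
  have hA1 : 1 ≤ A := by
    have h1 : 1 ≤ Real.exp (k + 1) := Real.one_le_exp (by positivity)
    have h2 : 1 ≤ Real.exp (k + 1) * k := one_le_mul_of_one_le_of_one_le h1 (by linarith)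
    exact one_le_mul_of_one_le_of_one_le h2 hN'
  have hkpos : (0 : ℝ) < k := by linarith
  let γ : ℝ := (1 / (2 * A)) ^ 4 / k
  have hγ : 0 < γ := by positivity
  have hγA : k * γ = (1 / (2 * A)) ^ 4 := by simp only [γ]; field_simp
  have hγ1 : k * γ ≤ 1 := by
    rw [hγA]
    refine pow_le_one₀ (by positivity) ?_
    rw [div_le_one (by positivity)]
    linarith
  refine ⟨γ, hγ, ?_⟩
  have hexp := tendsto_sum_union_bound (k := k) hA1 hγ hγA.le
  have hsat : Tendsto (fun n : ℕ => (2 / Real.exp 1) ^ n) atTop (𝓝 0) := by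
    refine tendsto_pow_atTop_nhds_zero_of_lt_one (by positivity) ?_
    rw [div_lt_one (Real.exp_pos 1)]
    have := Real.exp_one_gt_d9
    linarith
  have hlow : Tendsto (fun n : ℕ => 1 - (2 / Real.exp 1) ^ n -
      ∑ s ∈ Finset.Icc 1 ⌊γ * n⌋₊, A ^ s * ((k * s : ℝ) / n) ^ ((s + 3) / 4)) atTop (𝓝 1) := by
    simpa using (tendsto_const_nhds.sub hsat).sub hexp
  refine tendsto_of_tendsto_of_tendsto_of_le_of_le' hlow tendsto_const_nhds ?_
    (Eventually.of_forall fun n => uniformProb_le_one _)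
  filter_upwards [eventually_ge_atTop k] with n hn
  have hne := (M n).nonempty hN hn
  have hr : k * ⌊γ * n⌋₊ ≤ n := by
    have h1 : (⌊γ * n⌋₊ : ℝ) ≤ γ * n := Nat.floor_le (by positivity)
    have h2 : (k : ℝ) * ⌊γ * n⌋₊ ≤ n := by
      calc (k : ℝ) * ⌊γ * n⌋₊ ≤ k * (γ * n) := by gcongr
        _ = k * γ * n := by ring
        _ ≤ 1 * n := by gcongr
        _ = n := one_mul _
    exact_mod_cast h2
  refine le_trans ?_ (one_sub_le_uniformProb
    (B := {E : Fin (N * n) → α n | ∃ x, ∀ j, (M n).sat (E j) x})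
    (C := {E : Fin (N * n) → α n | ¬ Expanding (fun j => (M n).vars (E j)) ⌊γ * n⌋₊}) ?_)
  · have h1 := (M n).uniformProb_exists_sat_le hN hn
    have h2 := (M n).uniformProb_not_expanding_le hk hN hn hr
    linarith
  · intro E hB hC
    simp only [Set.mem_ofPred_eq, not_exists, not_forall, not_not] at hB hC ⊢
    exact ⟨hB, hC⟩

/-- Random formulas whose clauses follow from parity constraints on the sets of variables of their
constraints require linear depth with high probability. -/
theorem exists_tendsto_uniformProb_depth {k N : ℕ} (hk : 6 ≤ k) (hN : 0 < N) {α : ℕ → Type}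
    [∀ n, Fintype (α n)] (M : ∀ n, ConstraintFamily n k N (α n))
    (F : ∀ n, (Fin (N * n) → α n) → CNF n)
    (hunsat : ∀ n E, (∀ x, ∃ j, ¬ (M n).sat (E j) x) → (F n E).Unsat)
    (hpar : ∀ n E, ∃ b : Fin (N * n) → ZMod 2, ∀ C ∈ F n E, ∃ j, ∀ x : Fin n → Bool,
      parity ((M n).vars (E j)) x = b j → Clause.Sat C x) :
    ∃ κ : ℝ, 0 < κ ∧ Tendsto (fun n : ℕ => uniformProb {E : Fin (N * n) → α n |
      (F n E).Unsat ∧ (⌈κ * (n : ℝ)⌉₊ : ℕ∞) ≤ depthSCP (F n E)}) atTop (𝓝 1) := by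
  obtain ⟨γ, hγ, hlim⟩ := exists_tendsto_uniformProb_expanding hk hN M
  -- The walk needs `8 * t ≤ ⌊γ * n⌋₊`. Half of `γ * n` pays for `8 * κ * n` and the rest for
  -- rounding up, once `γ * n ≥ 18`.
  refine ⟨γ / 16, by positivity, ?_⟩
  refine tendsto_of_tendsto_of_tendsto_of_le_of_le' hlim tendsto_const_nhds ?_
    (Eventually.of_forall fun n => uniformProb_le_one _)
  filter_upwards [eventually_ge_atTop ⌈18 / γ⌉₊] with n hn
  refine uniformProb_mono fun E hE => ⟨hunsat n E hE.1, ?_⟩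
  obtain ⟨b, hb⟩ := hpar n E
  refine le_depthSCP_of_expanding b hb hE.2 ?_
  have h1 : 18 ≤ γ * n := by
    have := Nat.ceil_le.1 hn
    rwa [div_le_iff₀ hγ, mul_comm] at this
  rw [Nat.le_floor_iff (by positivity)]
  have h2 : (⌈γ / 16 * n⌉₊ : ℝ) < γ / 16 * n + 1 := Nat.ceil_lt_add_one (by positivity)
  push_cast
  linarith

/-! ### Random parity equations and random clauses -/

/-- The equations with `k` variables as a family of constraints. -/
def xorFamily (n k : ℕ) : ConstraintFamily n k 2 (KXor n k) where
  vars E := E.1.1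
  sat E x := E.Sat x
  card_vars E := E.1.2
  card_fiber s hs := by
    have h : (Finset.univ.filter fun E : KXor n k => E.1.1 = s) =
        {(⟨s, hs⟩ : {S : Finset (Fin n) // S.card = k})} ×ˢ (Finset.univ : Finset (ZMod 2)) := by
      ext ⟨⟨t, ht⟩, c⟩
      rw [Finset.mem_product]
      simp
    rw [h, Finset.card_product, Finset.card_singleton, Finset.card_univ, ZMod.card, one_mul]
  exists_not_sat x s hs := ⟨(⟨s, hs⟩, parity s x + 1), rfl, fun h => by
    change parity s x = parity s x + 1 at h
    simp at h⟩

theorem not_sat_image_not {n : ℕ} (s : Finset (Fin n)) (x y : Fin n → Bool) :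
    ¬ Clause.Sat (s.image fun i => (i, !(x i))) y ↔ ∀ i ∈ s, y i = x i := by
  simp only [Clause.Sat, Finset.mem_image, not_exists, not_and, forall_exists_index, and_imp,
    forall_apply_eq_imp_iff₂]
  exact forall₂_congr fun i _ => by cases x i <;> cases y i <;> simp

theorem xorFormula_unsat {m n k : ℕ} (E : Fin m → KXor n k) (h : ∀ x, ∃ j, ¬ (E j).Sat x) :
    (xorFormula E).Unsat := by
  intro x
  obtain ⟨j, hj⟩ := h x
  refine ⟨(E j).1.1.image fun i => (i, !(x i)), ?_, (not_sat_image_not _ _ _).2 fun _ _ => rfl⟩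
  simp only [xorFormula, Finset.mem_biUnion, Finset.mem_univ, true_and, KXor.toCNF,
    Finset.mem_image, Finset.mem_filter]
  exact ⟨j, x, hj, rfl⟩

theorem sat_of_mem_xorFormula {m n k : ℕ} (E : Fin m → KXor n k) {C : Clause n}
    (hC : C ∈ xorFormula E) : ∃ j, ∀ x : Fin n → Bool,
      parity (E j).1.1 x = (E j).2 → Clause.Sat C x := by
  simp only [xorFormula, Finset.mem_biUnion, Finset.mem_univ, true_and, KXor.toCNF,
    Finset.mem_image, Finset.mem_filter] at hC
  obtain ⟨j, y, hy, rfl⟩ := hC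
  refine ⟨j, fun x hx => ?_⟩
  by_contra hsat
  exact hy ((parity_congr fun i hi => ((not_sat_image_not _ _ _).1 hsat i hi).symm).trans hx)

theorem card_image_pair {n : ℕ} (s : Finset (Fin n)) (f : Fin n → Bool) :
    (s.image fun i => (i, f i)).card = s.card :=
  Finset.card_image_of_injective _ fun _ _ h => (Prod.ext_iff.1 h).1

theorem image_fst_image_pair {n : ℕ} (s : Finset (Fin n)) (f : Fin n → Bool) :
    (s.image fun i => (i, f i)).image Prod.fst = s := by
  rw [Finset.image_image]
  exact Finset.image_id

/-- The clauses with `k` literals as a family of constraints. -/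
def clauseFamily (n k : ℕ) : ConstraintFamily n k (2 ^ k) (KClause n k) where
  vars C := C.1.image Prod.fst
  sat C x := Clause.Sat C.1 x
  card_vars C := C.2.2
  card_fiber s hs := by
    rw [← hs, ← Finset.card_powerset]
    symm
    -- A clause on the variables `s` is encoded by the set of its positive variables.
    refine Finset.card_bij (fun P _ => ⟨s.image fun i => (i, decide (i ∈ P)),
      by rw [card_image_pair, hs], by rw [image_fst_image_pair, hs]⟩) ?_ ?_ ?_
    · intro P _
      simp only [Finset.mem_filter, Finset.mem_univ, true_and]
      exact image_fst_image_pair s _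
    · intro P hP Q hQ h
      rw [Finset.mem_powerset] at hP hQ
      have key : ∀ R ⊆ s, ∀ i, i ∈ R ↔ (i, true) ∈ s.image fun i => (i, decide (i ∈ R)) := by
        intro R hR i
        simp only [Finset.mem_image, Prod.mk.injEq, decide_eq_true_eq]
        exact ⟨fun hi => ⟨i, hR hi, rfl, hi⟩, fun ⟨_, _, h1, h2⟩ => h1 ▸ h2⟩
      ext i
      rw [key P hP, key Q hQ]
      exact Finset.ext_iff.1 (Subtype.ext_iff.1 h) (i, true)
    · rintro ⟨C, hC, hC'⟩ hCs
      simp only [Finset.mem_filter, Finset.mem_univ, true_and] at hCs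
      refine ⟨s.filter fun i => (i, true) ∈ C, by simp, Subtype.ext ?_⟩
      refine Finset.eq_of_subset_of_card_le ?_ (by rw [card_image_pair, hC, hs])
      intro l hl
      obtain ⟨i, hi, rfl⟩ := Finset.mem_image.1 hl
      rw [← hCs] at hi
      obtain ⟨⟨i', c⟩, hic, rfl⟩ := Finset.mem_image.1 hi
      by_cases ht : (i', true) ∈ C
      · simp [ht, ← hCs]
      · cases c
        · simpa [ht] using hic
        · exact absurd hic ht
  exists_not_sat x s hs := ⟨⟨s.image fun i => (i, !(x i)), by rw [card_image_pair, hs],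
    by rw [image_fst_image_pair, hs]⟩, image_fst_image_pair s _,
    (not_sat_image_not _ _ _).2 fun _ _ => rfl⟩

theorem cnfFormula_unsat {m n k : ℕ} (C : Fin m → KClause n k)
    (h : ∀ x, ∃ j, ¬ Clause.Sat (C j).1 x) : (cnfFormula C).Unsat := by
  intro x
  obtain ⟨j, hj⟩ := h x
  exact ⟨_, Finset.mem_image_of_mem _ (Finset.mem_univ j), hj⟩

/-- A clause follows from one of the two parity equations on its variables. -/
theorem sat_of_parity_eq {n k : ℕ} (C : KClause n k) (x : Fin n → Bool)
    (hx : parity (C.1.image Prod.fst) x = (∑ l ∈ C.1, if l.2 then (0 : ZMod 2) else 1) + 1) :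
    Clause.Sat C.1 x := by
  by_contra hsat
  have hinj : Set.InjOn Prod.fst (C.1 : Set (Literal n)) :=
    Finset.card_image_iff.1 (C.2.2.trans C.2.1.symm)
  -- A falsifying assignment is 0 on positive and 1 on negative literals, so its parity is the
  -- number of negative literals; the added 1 in `hx` excludes it.
  have h1 : parity (C.1.image Prod.fst) x = ∑ l ∈ C.1, if l.2 then (0 : ZMod 2) else 1 := by
    unfold parity
    rw [Finset.sum_image hinj]
    refine Finset.sum_congr rfl fun l hl => ?_
    have h2 : x l.1 ≠ l.2 := fun h => hsat ⟨l, hl, h⟩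
    cases h3 : l.2 <;> cases h4 : x l.1 <;> simp_all
  rw [h1] at hx
  simp at hx

end SemanticCP

theorem mainTheorem10 (k : ℕ) (hk : 6 ≤ k) :
    (∃ m : ℕ → ℕ, (fun n => (m n : ℝ)) =O[atTop] (fun n => (n : ℝ)) ∧
      ∃ κ : ℝ, 0 < κ ∧
        Tendsto
          (fun n : ℕ => SemanticCP.uniformProb
            {E : Fin (m n) → SemanticCP.KXor n k |
              (SemanticCP.xorFormula E).Unsat ∧
                (⌈κ * (n : ℝ)⌉₊ : ℕ∞) ≤ SemanticCP.depthSCP (SemanticCP.xorFormula E)})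
          atTop (𝓝 1)) ∧
    (∃ m : ℕ → ℕ, (fun n => (m n : ℝ)) =O[atTop] (fun n => (n : ℝ)) ∧
      ∃ κ : ℝ, 0 < κ ∧
        Tendsto
          (fun n : ℕ => SemanticCP.uniformProb
            {C : Fin (m n) → SemanticCP.KClause n k |
              (SemanticCP.cnfFormula C).Unsat ∧
                (⌈κ * (n : ℝ)⌉₊ : ℕ∞) ≤ SemanticCP.depthSCP (SemanticCP.cnfFormula C)})
          atTop (𝓝 1)) := by
  have hO : ∀ N : ℕ, (fun n : ℕ => ((N * n : ℕ) : ℝ)) =O[atTop] (fun n => (n : ℝ)) := fun N => by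
    simpa using (isBigO_refl (fun n : ℕ => (n : ℝ)) atTop).const_mul_left (N : ℝ)
  constructor
  -- The factor in `m` is the number of constraints per variable set: 2 right-hand sides here, `2 ^
  -- k` sign patterns for clauses.
  · exact ⟨fun n => 2 * n, hO 2, SemanticCP.exists_tendsto_uniformProb_depth hk two_pos
      (fun n => SemanticCP.xorFamily n k) (fun _ => SemanticCP.xorFormula)
      (fun _ => SemanticCP.xorFormula_unsat)
      fun _ E => ⟨fun j => (E j).2, fun _ hC => SemanticCP.sat_of_mem_xorFormula E hC⟩⟩
  · refine ⟨fun n => 2 ^ k * n, hO _, SemanticCP.exists_tendsto_uniformProb_depth hk (by positivity)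
      (fun n => SemanticCP.clauseFamily n k) (fun _ => SemanticCP.cnfFormula)
      (fun _ => SemanticCP.cnfFormula_unsat)
      fun _ E => ⟨fun j => (∑ l ∈ (E j).1, if l.2 then (0 : ZMod 2) else 1) + 1, fun C hC => ?_⟩⟩
    obtain ⟨j, -, rfl⟩ := Finset.mem_image.1 hC
    exact ⟨j, SemanticCP.sat_of_parity_eq (E j)⟩
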